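/- A mixed graph $X$ is a finite simple graph $\Gamma(X)$ (the underlying graph) in which some edges are given an orientation (arcs) and the others are not (digons). For a complex number $\alpha$ with $|\alpha|=1$ (for example $\alpha=e^{2\pi i/n}$), its $\alpha$-hermitian adjacency matrix $H_\alpha=[h_{ab}]$ has $h_{ab}=1$ if $ab$ is a digon, $h_{ab}=\alpha$ if there is an arc from $a$ to $b$, $h_{ab}=\overline{\alpha}$ if there is an arc from $b$ to $a$, and $h_{ab}=0$ otherwise. For a walk $W=r_1r_2\dots r_k$ in $\Gamma(X)$ put $h_\alpha(W)=h_{r_1r_2}h_{r_2r_3}\cdots h_{r_{k-1}r_k}$. Let $X$ be a mixed graph whose underlying graph is bipartite, is unicyclic (connected with exactly one cycle $C$), and has a unique perfect matching $\mathcal M$; let $2m$ be the length of $C$. A peg is an edge of $\mathcal M$ that is not an edge of $C$ and is incident to a vertex of $C$. A path is co-augmenting if its edges alternate between $\mathcal M$ and the complement of $\mathcal M$ and its first and last edges belong to $\mathcal M$. Theorem. Suppose that $X$ has exactly two pegs, and that there are two different co-augmenting paths from the vertex $x$ to the vertex $y$; let $P$ be one of them. Then $H_\alpha$ is invertible, and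 the pegs can be written as $uv$ and $u'v'$, with $v$ and $v'$ on $C$, so that $P$ is the concatenation of a path $P_{x\to v}$ from $x$ to $v$, a path $\mathcal F_{v\to v'}$ from $v$ to $v'$ which is the part of $P$ in $C$, and a path $P_{v'\to y}$ from $v'$ to $y$. Let $\mathcal F^c_{v\to v'}$ be the other path from $v$ to $v'$ in $C$, let $\mathcal F_{v'\to v}$ be the reverse of $\mathcal F_{v\to v'}$, and let $h_\alpha(C)$ be the value of the closed walk around $C$ that runs from $v$ to $v'$ along $\mathcal F^c_{v\to v'}$ and returns from $v'$ to $v$ along $\mathcal F_{v'\to v}$. Then $$(H_\alpha^{-1})_{xy}=(-1)^{\frac{|E(P)|-1}{2}}\;\frac{h_\alpha(P_{x\to v})\,h_\alpha(P_{v'\to y})}{h_\alpha(\mathcal F_{v'\to v})}\,\Bigl[(-1)^{m+1}h_\alpha(C)+1\Bigr].$$ -/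

import Mathlib

open scoped ComplexConjugate

/-- A mixed graph on the vertex set `V`: a simple graph of undirected edges (digons) together with
directed edges (arcs). There are no loops, and two vertices are joined by at most one digon or arc. -/
structure MixedGraph (V : Type*) where
  /-- The undirected edges. -/
  digon : SimpleGraph V
  /-- `arc x y`: there is an arc with initial vertex `x` and terminal vertex `y`. -/
  arc : V → V → Prop
  arc_asymm : ∀ x y, arc x y → ¬ arc y x
  arc_not_digon : ∀ x y, arc x y → ¬ digon.Adj x y

namespace MixedGraph

variable {V : Type*}

/-- The underlying graph, obtained by forgetting the orientation of the arcs. -/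
def underlying (X : MixedGraph V) : SimpleGraph V where
  Adj x y := X.digon.Adj x y ∨ X.arc x y ∨ X.arc y x
  symm := ⟨fun _ _ h => h.elim (fun h => Or.inl h.symm) (fun h => Or.inr h.symm)⟩
  loopless := ⟨fun x h => h.elim (fun h => X.digon.loopless.irrefl x h)
    (fun h => h.elim (fun h => X.arc_asymm x x h h) (fun h => X.arc_asymm x x h h))⟩

open Classical in
/-- The `α`-hermitian adjacency matrix. -/
noncomputable def hermitianAdj (X : MixedGraph V) (α : ℂ) : Matrix V V ℂ :=
  Matrix.of fun x y =>
    if X.digon.Adj x y then 1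
    else if X.arc x y then α
    else if X.arc y x then conj α
    else 0

/-- The value `h_α(W)` of a walk `W = r₁, r₂, …, r_k`: the product of the entries
`h_{r₁r₂} h_{r₂r₃} ⋯` of the `α`-hermitian adjacency matrix along the walk. -/
noncomputable def walkValue (X : MixedGraph V) (α : ℂ) {x y : V} (W : X.underlying.Walk x y) : ℂ :=
  (W.darts.map fun d => X.hermitianAdj α d.fst d.snd).prod

end MixedGraph

namespace SimpleGraph

variable {V : Type*}

/-- A unicyclic graph: a connected graph with exactly one cycle (a cycle being determined by its
set of edges). -/
def IsUnicyclic (G : SimpleGraph V) : Prop :=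
  G.Connected ∧ ∃ (w : V) (c : G.Walk w w), c.IsCycle ∧
    ∀ (w' : V) (d : G.Walk w' w'), d.IsCycle → ∀ e, e ∈ d.edges ↔ e ∈ c.edges

/-- A path is co-augmenting with respect to the matching `M` if its edges alternate between matching
and non-matching edges, and its first and its last edge are matching edges. -/
structure IsCoaugmenting {G : SimpleGraph V} (M : G.Subgraph) {x y : V} (P : G.Walk x y) :
    Prop where
  isPath : P.IsPath
  alternating : P.edges.IsChain fun e f => e ∈ M.edgeSet ↔ f ∉ M.edgeSet
  first_mem : ∃ e, P.edges.head? = some e ∧ e ∈ M.edgeSet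
  last_mem : ∃ e, P.edges.getLast? = some e ∧ e ∈ M.edgeSet

/-- A peg of the cycle `c`: a matching edge that is not an edge of the cycle and is incident to a
vertex of the cycle. -/
def IsPeg {G : SimpleGraph V} (M : G.Subgraph) {w : V} (c : G.Walk w w) (e : Sym2 V) : Prop :=
  e ∈ M.edgeSet ∧ e ∉ c.edges ∧ ∃ z ∈ c.support, z ∈ e

end SimpleGraph

/-! ### Two paths with common ends in a graph with one cycle. -/

namespace SimpleGraph

variable {V : Type*} {G : SimpleGraph V}

/-! Write `p a` for the partner of `a` in the matching, and let `a → b` mean that `p a` is adjacent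
to `b` and `b ≠ a`: a matching edge followed by a non-matching one. In a finite bipartite graph, a
closed chain of such steps would allow the matching to be rotated into another perfect matching, so
uniqueness makes the relation well-founded (`wellFounded_alternating`). Row `p z` of `H f = g` then
expresses `f z` through `g (p z)` and the values of `f` at the successors of `z`. With `g = 0` this
recursion forces `f = 0`, so `H` is invertible. With `g` the basis vector at `y`, it unrolls into a
sum over the co-augmenting paths `W` from `x` to `y` of `(-1) ^ ((|W| - 1) / 2) * h(W)`
(`inv_hermitianAdj_eq_sum`). With a single cycle there are at most two paths between two vertices
(`Walk.IsPath.eq_or_eq_of_ne`), so the sum has just the terms of `P` and `Q`. These paths differ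
only in which side of the cycle they follow. The edges before and after that side are matching edges
off the cycle, hence the two pegs; the sides have odd length, and comparing lengths gives the
relative sign `(-1) ^ (m + 1)`. -/

/-- A walk that ends in `s` splits at its first vertex in `s`. -/
lemma Walk.exists_eq_append_first_mem (s : Set V) {x y : V} (P : G.Walk x y) (hy : y ∈ s) :
    ∃ (v : V) (A : G.Walk x v) (B : G.Walk v y), v ∈ s ∧ P = A.append B ∧
      ∀ u ∈ A.support, u ∈ s → u = v := by
  induction P with
  | nil => exact ⟨_, .nil, .nil, hy, rfl, by simp⟩
  | @cons a b c h P ih =>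
    by_cases ha : a ∈ s
    · exact ⟨a, .nil, .cons h P, ha, rfl, by simp⟩
    · obtain ⟨v, A, B, hv, rfl, hA⟩ := ih hy
      refine ⟨v, .cons h A, B, hv, rfl, fun u hu hus => ?_⟩
      rw [Walk.support_cons, List.mem_cons] at hu
      rcases hu with rfl | hu
      · exact absurd hus ha
      · exact hA u hu hus

/-- Two different paths with the same ends agree up to a vertex `v`, from where they run along
two sides of a cycle to a vertex `v'`. -/
lemma Walk.IsPath.exists_isCycle_append_of_ne {x y : V} {P Q : G.Walk x y} (hP : P.IsPath)
    (hQ : Q.IsPath) (hPQ : P ≠ Q) :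
    ∃ (v v' : V) (A : G.Walk x v) (F F' : G.Walk v v') (B B' : G.Walk v' y),
      P = A.append (F.append B) ∧ Q = A.append (F'.append B') ∧
        (F'.append F.reverse).IsCycle := by
  induction P with
  | nil => exact absurd (Walk.eq_nil_iff_nil.mpr (Walk.isPath_iff_nil.mp hQ)).symm hPQ
  | @cons a b c h P ih =>
    cases Q with
    | nil => exact absurd (Walk.isPath_iff_nil.mp hP) Walk.not_nil_cons
    | @cons _ b' _ h' Q =>
      by_cases hbb : b = b'
      · subst hbb
        obtain ⟨v, v', A, F, F', B, B', rfl, rfl, hc⟩ := ih hP.of_cons hQ.of_cons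
          (fun e => hPQ (by rw [e]))
        exact ⟨v, v', .cons h A, F, F', B, B', rfl, rfl, hc⟩
      · rw [Walk.cons_isPath_iff] at hP hQ
        -- The first return of `P` to `Q` closes the cycle: before `v'` the two sides share only
        -- `a`.
        obtain ⟨v', F, B, hv', rfl, hF⟩ :=
          P.exists_eq_append_first_mem {u | u ∈ Q.support} (Walk.end_mem_support Q)
        obtain ⟨F', B', rfl⟩ := Walk.mem_support_iff_exists_append.mp hv'
        have hFp : (Walk.cons h F).IsPath := by
          rw [Walk.cons_isPath_iff]
          exact ⟨hP.1.of_append_left, fun ha => hP.2 (by simp [ha])⟩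
        have hF'p : (Walk.cons h' F').IsPath := by
          rw [Walk.cons_isPath_iff]
          exact ⟨hQ.1.of_append_left, fun ha => hQ.2 (by simp [ha])⟩
        refine ⟨a, v', .nil, .cons h F, .cons h' F', B, B', rfl, rfl, ?_⟩
        refine hF'p.isCycle_append ((Walk.isPath_reverse_iff _).mpr hFp) ?_ ?_
        · intro u hu hu'
          rw [Walk.support_cons, List.tail_cons] at hu
          have hu2 : u ∈ (Walk.cons h F).support := by
            have := List.mem_of_mem_tail hu'
            rwa [Walk.support_reverse, List.mem_reverse] at this
          rw [Walk.support_cons, List.mem_cons] at hu2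
          rcases hu2 with rfl | hu2
          · exact hQ.2 (by simp [hu])
          · have := hF u hu2 (by simp [hu])
            subst this
            have hn := ((Walk.isPath_reverse_iff _).mpr hFp).support_nodup
            rw [← Walk.cons_tail_support] at hn
            exact (List.nodup_cons.mp hn).1 hu'
        -- If both sides were single edges, then `b = v' = b'`.
        · by_contra! hcon
          cases F with
          | nil =>
            cases F' with
            | nil => exact hbb rfl
            | cons _ _ => simp at hcon
          | cons _ _ => simp at hcon

lemma Walk.IsPath.start_notMem_support_of_append {x y z : V} {A : G.Walk x y} {B : G.Walk y z}
    (h : (A.append B).IsPath) (hxy : x ≠ y) : x ∉ B.support := by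
  intro hx
  have hn := h.support_nodup
  rw [Walk.support_append] at hn
  rw [← Walk.cons_tail_support, List.mem_cons] at hx
  exact List.disjoint_of_nodup_append hn A.start_mem_support (hx.resolve_left hxy)

/-- If all cycles have the same edges, two different paths with the same ends agree except for
the two sides of a cycle. -/
lemma Walk.IsPath.exists_isCycle_append_of_ne_of_unique {w : V} {C : G.Walk w w}
    (hC : ∀ (w' : V) (d : G.Walk w' w'), d.IsCycle → ∀ e, e ∈ d.edges ↔ e ∈ C.edges)
    {x y : V} {P Q : G.Walk x y} (hP : P.IsPath) (hQ : Q.IsPath) (hPQ : P ≠ Q) :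
    ∃ (v v' : V) (A : G.Walk x v) (F F' : G.Walk v v') (B : G.Walk v' y),
      P = A.append (F.append B) ∧ Q = A.append (F'.append B) ∧
        (F'.append F.reverse).IsCycle := by
  obtain ⟨v, v', A, F, F', B, B', rfl, rfl, hc⟩ := hP.exists_isCycle_append_of_ne hQ hPQ
  -- Different tails would contain a second cycle. It has the edges of the first, so it passes
  -- through `v`; but neither path returns to `v`.
  obtain rfl : B = B' := by
    by_contra hB
    have hFB := hP.of_append_right
    have hFB' := hQ.of_append_right
    obtain ⟨z, z', A₁, F₁, F₁', B₁, B₁', rfl, rfl, hc₁⟩ :=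
      hFB.of_append_right.exists_isCycle_append_of_ne hFB'.of_append_right hB
    have hvv : v ≠ v' := by
      rintro rfl
      have h1 := Walk.eq_nil_iff_nil.mpr (Walk.isPath_iff_nil.mp hFB.of_append_left)
      have h2 := Walk.eq_nil_iff_nil.mpr (Walk.isPath_iff_nil.mp hFB'.of_append_left)
      subst h1 h2
      exact hc.ne_nil rfl
    obtain ⟨e, he, hve⟩ : ∃ e ∈ (F'.append F.reverse).edges, v ∈ e := by
      generalize F'.append F.reverse = d at hc
      cases d with
      | nil => exact absurd rfl hc.ne_nil
      | cons h p => exact ⟨_, List.mem_cons_self, Sym2.mem_mk_left _ _⟩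
    rw [hC _ _ hc, ← hC _ _ hc₁] at he
    have hv := Walk.mem_support_of_mem_edges he hve
    rw [Walk.mem_support_append_iff, Walk.support_reverse, List.mem_reverse] at hv
    rcases hv with hv | hv
    · exact hFB'.start_notMem_support_of_append hvv (by simp [hv])
    · exact hFB.start_notMem_support_of_append hvv (by simp [hv])
  exact ⟨v, v', A, F, F', B, rfl, rfl, hc⟩

/-- An edge of the cycle outside `F` lies in `F'`, which is disjoint from `A` and `B` in one trail
and from `F` in the other. -/
lemma Walk.IsTrail.mem_edges_middle_iff {x y v v' : V} {A : G.Walk x v} {F F' : G.Walk v v'}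
    {B : G.Walk v' y} (hQ : (A.append (F'.append B)).IsTrail)
    (hc : (F'.append F.reverse).IsTrail) (e : Sym2 V) :
    e ∈ F.edges ↔ e ∈ (A.append (F.append B)).edges ∧ e ∈ (F'.append F.reverse).edges := by
  have h1 := hQ.edges_nodup
  have h2 := hc.edges_nodup
  simp only [Walk.edges_append, Walk.edges_reverse, List.nodup_append', List.mem_append,
    List.mem_reverse, List.disjoint_left] at *
  grind

/-- If all cycles have the same edges, each edge of a cycle lies on exactly one of two different
paths with the same ends. -/
lemma Walk.IsPath.mem_edges_iff_notMem_of_ne {w : V} {C : G.Walk w w}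
    (hC : ∀ (w' : V) (d : G.Walk w' w'), d.IsCycle → ∀ e, e ∈ d.edges ↔ e ∈ C.edges)
    {x y : V} {P Q : G.Walk x y} (hP : P.IsPath) (hQ : Q.IsPath) (hPQ : P ≠ Q)
    {e : Sym2 V} (he : e ∈ C.edges) : e ∈ P.edges ↔ e ∉ Q.edges := by
  obtain ⟨v, v', A, F, F', B, rfl, rfl, hc⟩ :=
    hP.exists_isCycle_append_of_ne_of_unique hC hQ hPQ
  rw [← hC _ _ hc] at he
  have h0 := hP.isTrail.edges_nodup
  have h1 := hQ.isTrail.edges_nodup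
  have h2 := hc.isTrail.edges_nodup
  simp only [Walk.edges_append, Walk.edges_reverse, List.nodup_append', List.mem_append,
    List.mem_reverse, List.disjoint_left] at *
  grind

/-- If all cycles have the same edges, there are at most two paths between two vertices. -/
lemma Walk.IsPath.eq_or_eq_of_ne {w : V} {C : G.Walk w w} (hCc : C.IsCycle)
    (hC : ∀ (w' : V) (d : G.Walk w' w'), d.IsCycle → ∀ e, e ∈ d.edges ↔ e ∈ C.edges)
    {x y : V} {P Q R : G.Walk x y} (hP : P.IsPath) (hQ : Q.IsPath) (hR : R.IsPath)
    (hPQ : P ≠ Q) : R = P ∨ R = Q := by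
  by_contra! h
  obtain ⟨e, he⟩ : ∃ e, e ∈ C.edges := by
    cases C with
    | nil => exact absurd rfl hCc.ne_nil
    | cons h p => exact ⟨_, List.mem_cons_self⟩
  -- Membership of `e` would have three pairwise different truth values.
  have h1 := hP.mem_edges_iff_notMem_of_ne hC hQ hPQ he
  have h2 := hR.mem_edges_iff_notMem_of_ne hC hQ h.2 he
  have h3 := hR.mem_edges_iff_notMem_of_ne hC hP h.1 he
  tauto

end SimpleGraph

/-! ### Unique perfect matchings and alternating walks. -/

namespace SimpleGraph

variable {V : Type*} {G : SimpleGraph V}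

lemma exists_partner {M : G.Subgraph} (hM : M.IsPerfectMatching) :
    ∃ p : V → V, ∀ a b, M.Adj a b ↔ p a = b := by
  choose p hp hp' using Subgraph.isPerfectMatching_iff.mp hM
  exact ⟨p, fun a b => ⟨fun h => (hp' a b h).symm, fun h => h ▸ hp a⟩⟩

/-- On a finite type, a relation with an infinite chain admits a nontrivial permutation along
its edges. -/
lemma _root_.WellFounded.flip_of_forall_perm_eq_one {α : Type*} [Finite α] {r : α → α → Prop}
    (h : ∀ g : Equiv.Perm α, (∀ a, g a = a ∨ r a (g a)) → ∀ a, r a (g a) → g a = a)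
    (hirr : ∀ a, ¬ r a a) : WellFounded (flip r) := by
  classical
  rw [WellFounded.wellFounded_iff_has_min]
  intro S ⟨s, hs⟩
  by_contra! hS
  simp only [flip] at hS
  choose! f hfS hf using hS
  have hit : ∀ n, f^[n] s ∈ S := fun n => by
    induction n with
    | zero => exact hs
    | succ n ih => rw [Function.iterate_succ_apply']; exact hfS _ ih
  obtain ⟨i, j, hij, hne⟩ : ∃ i j, i < j ∧ f^[i] s = f^[j] s := by
    obtain ⟨i, j, hij, h⟩ := Finite.exists_ne_map_eq_of_infinite (fun n => f^[n] s)
    rcases lt_or_gt_of_ne hij with hlt | hlt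
    · exact ⟨i, j, hlt, h⟩
    · exact ⟨j, i, hlt, h.symm⟩
  -- A choice `f` of successors is bijective on its periodic points, so `f` on `T` and the identity
  -- elsewhere form a permutation.
  set T := Function.periodicPts f ∩ S with hT
  have htT : f^[i] s ∈ T := by
    refine ⟨Function.mk_mem_periodicPts (n := j - i) (by omega) ?_, hit i⟩
    rw [Function.IsPeriodicPt, Function.IsFixedPt, ← Function.iterate_add_apply]
    rw [Nat.sub_add_cancel hij.le]
    exact hne.symm
  have hbij := Function.bijOn_periodicPts f
  let g : α → α := fun a => if a ∈ T then f a else a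
  have hfT : ∀ a ∈ T, f a ∈ T := fun a ha => ⟨hbij.mapsTo ha.1, hfS a ha.2⟩
  have hginj : Function.Injective g := by
    intro a b hab
    by_cases ha : a ∈ T <;> by_cases hb : b ∈ T <;> simp only [g, ha, hb, if_true, if_false] at hab
    · exact hbij.injOn ha.1 hb.1 hab
    · exact absurd (hab ▸ hfT a ha) hb
    · exact absurd (hab ▸ hfT b hb) ha
    · exact hab
  let σ : Equiv.Perm α := Equiv.ofBijective g (Finite.injective_iff_bijective.mp hginj)
  have hσ : ∀ a, σ a = if a ∈ T then f a else a := fun _ => rfl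
  have hrt : r (f^[i] s) (σ (f^[i] s)) := by
    rw [hσ, if_pos htT]; exact hf _ htT.2
  have := h σ (fun a => by
    by_cases ha : a ∈ T
    · right; rw [hσ, if_pos ha]; exact hf a ha.2
    · left; rw [hσ, if_neg ha]) _ hrt
  rw [this] at hrt
  exact hirr _ hrt

/-- In a finite bipartite graph with a unique perfect matching, there is no infinite walk that
alternates between the matching and its complement. -/
lemma wellFounded_alternating [Finite V] (hbip : G.IsBipartite) {M : G.Subgraph}
    (hMuniq : ∀ M' : G.Subgraph, M'.IsPerfectMatching → M' = M)
    {p : V → V} (hp : ∀ a b, M.Adj a b ↔ p a = b) :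
    WellFounded (flip fun a b => G.Adj (p a) b ∧ b ≠ a) := by
  obtain ⟨c⟩ := hbip
  have hadj : ∀ a, G.Adj a (p a) := fun a => ((hp a _).mpr rfl).adj_sub
  have hpp : ∀ a, p (p a) = a := fun a => (hp _ _).mp ((hp a _).mpr rfl).symm
  have hflip : ∀ {a b}, G.Adj a b → ∀ k, (c a = k ↔ c b ≠ k) := fun {a b} h k => by
    have := c.valid h
    omega
  refine WellFounded.flip_of_forall_perm_eq_one (fun g hg a₀ ha₀ => ?_) (fun a h => h.2 rfl)
  have hgadj : ∀ a, G.Adj (p a) (g a) := fun a => by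
    rcases hg a with h | h
    · rw [h]; exact (hadj a).symm
    · exact h.1
  have hgc : ∀ a, c (g a) = c a := fun a => by
    have h1 := c.valid (hgadj a)
    have h2 := c.valid (hadj a)
    omega
  have hpc : ∀ a k, (c a = k ↔ c (p a) ≠ k) := fun a => hflip (hadj a)
  -- The rotated matching: `u` outside the colour class of `a₀` is matched with `g (p u)` in place
  -- of `p u`. As `g` preserves colours, this pairs the two classes; `M' = M` then gives `g a₀ =
  -- a₀`.
  let M' : G.Subgraph :=
    { verts := Set.univ
      Adj := fun u w => (c u ≠ c a₀ ∧ w = g (p u)) ∨ (c w ≠ c a₀ ∧ u = g (p w))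
      adj_sub := by
        rintro u w (⟨-, rfl⟩ | ⟨-, rfl⟩)
        · simpa [hpp] using hgadj (p u)
        · simpa [hpp] using (hgadj (p w)).symm
      edge_vert := fun _ => Set.mem_univ _
      symm := ⟨fun _ _ h => h.symm⟩ }
  have hM' : M'.IsPerfectMatching := by
    rw [Subgraph.isPerfectMatching_iff]
    intro u
    by_cases hu : c u = c a₀
    · refine ⟨p (g.symm u), Or.inr ⟨?_, by simp [hpp]⟩, ?_⟩
      · rw [← hpc, ← hu, ← hgc, Equiv.apply_symm_apply]
      · rintro w (⟨h, -⟩ | ⟨-, h⟩)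
        · exact absurd hu h
        · rw [h, Equiv.symm_apply_apply, hpp]
    · refine ⟨g (p u), Or.inl ⟨hu, rfl⟩, ?_⟩
      rintro w (⟨-, h⟩ | ⟨h, h'⟩)
      · exact h
      · refine absurd ?_ hu
        rw [h', hgc]
        by_contra h2
        exact h ((hpc w _).mpr h2)
  have hMM := hMuniq M' hM'
  have h1 : M'.Adj (p a₀) (g a₀) := Or.inl ⟨(hpc _ _).mp rfl, by rw [hpp]⟩
  rw [hMM, hp, hpp] at h1
  exact h1.symm

end SimpleGraph

/-! ### Co-augmenting paths, two edges at a time. -/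

namespace SimpleGraph

variable {V : Type*} {G : SimpleGraph V}

lemma not_isCoaugmenting_nil {M : G.Subgraph} {a : V} :
    ¬ IsCoaugmenting M (Walk.nil : G.Walk a a) := fun h => by
  obtain ⟨e, he, -⟩ := h.first_mem
  simp at he

lemma isCoaugmenting_cons_nil {M : G.Subgraph} {a b : V} (h : G.Adj a b) :
    IsCoaugmenting M (Walk.cons h .nil) ↔ M.Adj a b := by
  constructor
  · intro hW
    obtain ⟨e, he, he'⟩ := hW.first_mem
    simp only [Walk.edges_cons, List.head?_cons, Option.some.injEq] at he
    subst he
    exact he'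
  · intro hM
    refine ⟨by simpa using h.ne, by simp, ⟨s(a, b), by simp, hM⟩, ⟨s(a, b), by simp, hM⟩⟩

lemma isCoaugmenting_cons_cons {M : G.Subgraph} {a b c y : V} (h : G.Adj a b) (h' : G.Adj b c)
    (W : G.Walk c y) :
    IsCoaugmenting M (Walk.cons h (.cons h' W)) ↔
      M.Adj a b ∧ ¬ M.Adj b c ∧ IsCoaugmenting M W ∧ a ∉ W.support ∧ b ∉ W.support := by
  constructor
  · rintro ⟨hp, halt, ⟨e, he, heM⟩, hl⟩
    simp only [Walk.edges_cons, List.head?_cons, Option.some.injEq] at he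
    subst he
    have hab : M.Adj a b := heM
    rw [Walk.edges_cons, Walk.edges_cons, List.isChain_cons_cons] at halt
    have hbc : ¬ M.Adj b c := halt.1.mp heM
    simp only [Walk.cons_isPath_iff, Walk.support_cons, List.mem_cons, not_or] at hp
    refine ⟨hab, hbc, ?_, hp.2.2, hp.1.2⟩
    have hne : W.edges ≠ [] := fun hn => by
      obtain ⟨e, he, heM⟩ := hl
      simp only [Walk.edges_cons, hn, List.getLast?_cons_cons, List.getLast?_singleton,
        Option.some.injEq] at he
      subst he
      exact hbc heM
    obtain ⟨f, l, hfl⟩ := List.exists_cons_of_ne_nil hne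
    rw [hfl, List.isChain_cons_cons] at halt
    refine ⟨hp.1.1, hfl ▸ halt.2.2, ⟨f, by simp [hfl], ?_⟩, ?_⟩
    · by_contra hf
      exact hbc (halt.2.1.mpr hf)
    · simpa [hfl] using hl
  · rintro ⟨hab, hbc, hW, ha, hb⟩
    obtain ⟨f, hf, hfM⟩ := hW.first_mem
    obtain ⟨l, hfl⟩ := List.head?_eq_some_iff.mp hf
    refine ⟨?_, ?_, ⟨s(a, b), by simp, hab⟩, ?_⟩
    · simp only [Walk.cons_isPath_iff, Walk.support_cons, List.mem_cons, not_or]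
      exact ⟨⟨hW.isPath, hb⟩, h.ne, ha⟩
    · have := hW.alternating
      rw [Walk.edges_cons, Walk.edges_cons, hfl, List.isChain_cons_cons, List.isChain_cons_cons]
      rw [hfl] at this
      simp only [Subgraph.mem_edgeSet]
      exact ⟨by tauto, by tauto, this⟩
    · simpa [hfl] using hW.last_mem

lemma Walk.exists_eq_cons_nil_of_length_eq_one {a b : V} :
    ∀ W : G.Walk a b, W.length = 1 → ∃ h : G.Adj a b, W = .cons h .nil
  | .cons h .nil, _ => ⟨h, rfl⟩

lemma Walk.eq_cons_nil_of_length_eq_one {a b : V} (h : G.Adj a b) (W : G.Walk a b)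
    (hl : W.length = 1) : W = .cons h .nil :=
  (W.exists_eq_cons_nil_of_length_eq_one hl).choose_spec

lemma IsCoaugmenting.length_eq_one_or_eq_cons_cons {M : G.Subgraph} {x y : V} :
    ∀ {W : G.Walk x y}, IsCoaugmenting M W → W.length = 1 ∨
      ∃ (b c : V) (h : G.Adj x b) (h' : G.Adj b c) (U : G.Walk c y), W = .cons h (.cons h' U)
  | .nil, hW => absurd hW not_isCoaugmenting_nil
  | .cons _ .nil, _ => .inl rfl
  | .cons h (.cons h' U), _ => .inr ⟨_, _, h, h', U, rfl⟩

/-- This turns a repeated vertex into a closed chain of the relation, which well-foundedness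
excludes. -/
lemma IsCoaugmenting.reflTransGen_of_mem_support {M : G.Subgraph} {p : V → V}
    (hp : ∀ a b, M.Adj a b ↔ p a = b) {x y : V} : ∀ {W : G.Walk x y}, IsCoaugmenting M W →
    ∀ u ∈ W.support, ∃ a, Relation.ReflTransGen (fun a b => G.Adj (p a) b ∧ b ≠ a) x a ∧
      (u = a ∨ u = p a)
  | .nil, hW => absurd hW not_isCoaugmenting_nil
  | .cons h .nil, hW => by
    rw [isCoaugmenting_cons_nil, hp] at hW
    subst hW
    intro u hu
    exact ⟨x, .refl, by simpa using hu⟩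
  | .cons h (.cons h' W), hW => by
    rw [isCoaugmenting_cons_cons, hp] at hW
    obtain ⟨rfl, hbc, hW, -, -⟩ := hW
    intro u hu
    simp only [Walk.support_cons, List.mem_cons] at hu
    rcases hu with hu | hu | hu
    · exact ⟨x, .refl, .inl hu⟩
    · exact ⟨x, .refl, .inr hu⟩
    · obtain ⟨a, ha, hua⟩ := hW.reflTransGen_of_mem_support hp u hu
      refine ⟨a, .head ⟨h', ?_⟩ ha, hua⟩
      rintro rfl
      exact hbc ((hp _ _).mpr rfl).symm

/-- When there is no infinite alternating walk, a co-augmenting path may be prolonged by a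
matching edge and a non-matching edge. -/
lemma IsCoaugmenting.cons_cons (hbip : G.IsBipartite) {M : G.Subgraph} {p : V → V}
    (hp : ∀ a b, M.Adj a b ↔ p a = b)
    (hwf : WellFounded (flip fun a b => G.Adj (p a) b ∧ b ≠ a)) {x z y : V}
    (h : G.Adj x (p x)) (h' : G.Adj (p x) z) (hzx : z ≠ x) {W : G.Walk z y}
    (hW : IsCoaugmenting M W) : IsCoaugmenting M (Walk.cons h (.cons h' W)) := by
  obtain ⟨c⟩ := hbip
  have hadj : ∀ a, G.Adj a (p a) := fun a => ((hp a _).mpr rfl).adj_sub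
  have hpp : ∀ a, p (p a) = a := fun a => (hp _ _).mp ((hp a _).mpr rfl).symm
  -- Two-edge steps preserve the colour. Hence `x` and `p x` could recur only in their own roles,
  -- and either case would make `x` reachable from `z`.
  have hcol : ∀ a, Relation.ReflTransGen (fun a b => G.Adj (p a) b ∧ b ≠ a) z a → c a = c z := by
    intro a ha
    induction ha with
    | refl => rfl
    | @tail b d _ hbd ih =>
      have h1 := c.valid hbd.1
      have h2 := c.valid (hadj b)
      omega
  have hcz : c z = c x := by
    have h1 := c.valid h
    have h2 := c.valid h'
    omega
  have hno : ¬ Relation.ReflTransGen (fun a b => G.Adj (p a) b ∧ b ≠ a) z x := by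
    intro hr
    have ht : Relation.TransGen (fun a b => G.Adj (p a) b ∧ b ≠ a) x x := .head' ⟨h', hzx⟩ hr
    have hwf' := hwf.transGen
    refine hwf'.irrefl.irrefl x ?_
    rw [← Relation.transGen_swap] at ht
    exact ht
  rw [isCoaugmenting_cons_cons]
  refine ⟨(hp _ _).mpr rfl, ?_, hW, ?_, ?_⟩
  · rw [hp, hpp]
    exact hzx.symm
  · intro hx
    obtain ⟨a, ha, rfl | rfl⟩ := hW.reflTransGen_of_mem_support hp _ hx
    · exact hno ha
    · have := hcol a ha
      have := c.valid (hadj a)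
      omega
  · intro hx
    obtain ⟨a, ha, hxa | hxa⟩ := hW.reflTransGen_of_mem_support hp _ hx
    · have := hcol a ha
      have := c.valid h
      rw [hxa] at this
      omega
    · have : x = a := by rw [← hpp x, hxa, hpp]
      exact hno (this ▸ ha)

end SimpleGraph

/-! ### The matrix, and its inverse as a sum over co-augmenting paths. -/

namespace MixedGraph

variable {V : Type*} (X : MixedGraph V) (α : ℂ)

lemma hermitianAdj_of_not_adj {a b : V} (h : ¬ X.underlying.Adj a b) :
    X.hermitianAdj α a b = 0 := by
  simp only [underlying, not_or] at h
  simp [hermitianAdj, h]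

lemma hermitianAdj_mul_swap {α : ℂ} (hα : ‖α‖ = 1) {a b : V} (h : X.underlying.Adj a b) :
    X.hermitianAdj α a b * X.hermitianAdj α b a = 1 := by
  have h1 : α * conj α = 1 := by rw [Complex.mul_conj, Complex.normSq_eq_norm_sq, hα]; simp
  rcases h with h | h | h
  · simp [hermitianAdj, h, h.symm]
  · have h2 := X.arc_not_digon _ _ h
    have h3 : ¬ X.digon.Adj b a := fun h => h2 h.symm
    simp [hermitianAdj, h, h2, h3, X.arc_asymm _ _ h, h1]
  · have h2 := X.arc_not_digon _ _ h
    have h3 : ¬ X.digon.Adj a b := fun h => h2 h.symm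
    simp [hermitianAdj, h, h2, h3, X.arc_asymm _ _ h, mul_comm, h1]

@[simp] lemma walkValue_nil {a : V} :
    X.walkValue α (SimpleGraph.Walk.nil : X.underlying.Walk a a) = 1 := by
  simp [walkValue]

@[simp] lemma walkValue_cons {a b c : V} (h : X.underlying.Adj a b) (W : X.underlying.Walk b c) :
    X.walkValue α (.cons h W) = X.hermitianAdj α a b * X.walkValue α W := by
  simp [walkValue]

lemma walkValue_append {a b c : V} (W : X.underlying.Walk a b) (W' : X.underlying.Walk b c) :
    X.walkValue α (W.append W') = X.walkValue α W * X.walkValue α W' := by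
  simp [walkValue]

lemma walkValue_mul_reverse {α : ℂ} (hα : ‖α‖ = 1) {a b : V} (W : X.underlying.Walk a b) :
    X.walkValue α W * X.walkValue α W.reverse = 1 := by
  induction W with
  | nil => simp
  | @cons a b c h W ih =>
    rw [SimpleGraph.Walk.reverse_cons, walkValue_append, walkValue_cons, walkValue_cons,
      walkValue_nil, mul_one]
    linear_combination (X.hermitianAdj α a b * X.hermitianAdj α b a) * ih +
      X.hermitianAdj_mul_swap hα h

section Inverse

variable [Fintype V] {α}

/-- Row `p z` of the system is solved for `f z`; the coefficient there has inverse `h z (p z)`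
because `|α| = 1`. -/
lemma eq_of_hermitianAdj_mulVec (hα : ‖α‖ = 1) {M : X.underlying.Subgraph} {p : V → V}
    (hp : ∀ a b, M.Adj a b ↔ p a = b) {f g : V → ℂ} (hfg : (X.hermitianAdj α).mulVec f = g)
    (z : V) {s : Finset V} (hs : ∀ b, b ∈ s ↔ X.underlying.Adj (p z) b ∧ b ≠ z) :
    f z = X.hermitianAdj α z (p z) *
      (g (p z) - ∑ b ∈ s, X.hermitianAdj α (p z) b * f b) := by
  classical
  have hadj : X.underlying.Adj z (p z) := ((hp z _).mpr rfl).adj_sub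
  have h1 : ∑ b, X.hermitianAdj α (p z) b * f b = g (p z) := by
    rw [← hfg]; rfl
  rw [← Finset.sum_erase_add _ _ (Finset.mem_univ z)] at h1
  have h2 : ∑ b ∈ Finset.univ.erase z, X.hermitianAdj α (p z) b * f b =
      ∑ b ∈ s, X.hermitianAdj α (p z) b * f b := by
    symm
    refine Finset.sum_subset (fun b hb => by simp [((hs b).mp hb).2]) (fun b hb hb' => ?_)
    rw [hermitianAdj_of_not_adj, zero_mul]
    intro h
    exact hb' ((hs b).mpr ⟨h, by simpa using hb⟩)
  rw [h2] at h1
  rw [← h1, add_sub_cancel_left]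
  linear_combination (- f z) * X.hermitianAdj_mul_swap hα hadj

lemma isUnit_det_hermitianAdj [DecidableEq V] (hα : ‖α‖ = 1) {M : X.underlying.Subgraph}
    {p : V → V} (hp : ∀ a b, M.Adj a b ↔ p a = b)
    (hwf : WellFounded (flip fun a b => X.underlying.Adj (p a) b ∧ b ≠ a)) :
    IsUnit (X.hermitianAdj α).det := by
  classical
  rw [isUnit_iff_ne_zero]
  intro h0
  obtain ⟨f, hf, hf0⟩ := Matrix.exists_mulVec_eq_zero_iff.mpr h0
  refine hf (funext fun z => ?_)
  induction z using hwf.induction with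
  | _ z ih =>
    rw [X.eq_of_hermitianAdj_mulVec hα hp hf0 z
      (s := Finset.univ.filter fun b => X.underlying.Adj (p z) b ∧ b ≠ z) (by simp),
      Finset.sum_eq_zero]
    · simp
    · intro b hb
      rw [ih b (Finset.mem_filter.mp hb).2]
      simp

/-- The contribution of a walk to an entry of the inverse matrix. -/
noncomputable def signedValue (X : MixedGraph V) (α : ℂ) {x y : V} (W : X.underlying.Walk x y) :
    ℂ :=
  (-1) ^ ((W.length - 1) / 2) * X.walkValue α W

lemma inv_hermitianAdj_eq_sum [DecidableEq V] (hα : ‖α‖ = 1) (hbip : X.underlying.IsBipartite)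
    {M : X.underlying.Subgraph} {p : V → V} (hp : ∀ a b, M.Adj a b ↔ p a = b)
    (hwf : WellFounded (flip fun a b => X.underlying.Adj (p a) b ∧ b ≠ a)) (x y : V) :
    ∃ S : Finset (X.underlying.Walk x y), (∀ W, W ∈ S ↔ SimpleGraph.IsCoaugmenting M W) ∧
      (X.hermitianAdj α)⁻¹ x y = ∑ W ∈ S, signedValue X α W := by
  classical
  have hadj : ∀ a, X.underlying.Adj a (p a) := fun a => ((hp a _).mpr rfl).adj_sub
  have hpp : ∀ a, p (p a) = a := fun a => (hp _ _).mp ((hp a _).mpr rfl).symm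
  have hcol : (X.hermitianAdj α).mulVec (fun z => (X.hermitianAdj α)⁻¹ z y) =
      fun a => (1 : Matrix V V ℂ) a y := by
    rw [← Matrix.mul_nonsing_inv _ (X.isUnit_det_hermitianAdj hα hp hwf)]
    rfl
  induction x using hwf.induction with
  | _ z ih =>
    choose! S hS hSsum using ih
    set T := Finset.univ.filter (fun b => X.underlying.Adj (p z) b ∧ b ≠ z) with hT
    have hf := X.eq_of_hermitianAdj_mulVec hα hp hcol z (s := T) (by simp [hT])
    -- The inhomogeneous term of the recursion accounts for the path of one edge, present exactly
    -- when `y = p z`.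
    obtain ⟨S₀, hS₀, hS₀sum⟩ : ∃ S₀ : Finset (X.underlying.Walk z y),
        (∀ W, W ∈ S₀ ↔ SimpleGraph.IsCoaugmenting M W ∧ W.length = 1) ∧
        ∑ W ∈ S₀, signedValue X α W = X.hermitianAdj α z (p z) * (1 : Matrix V V ℂ) (p z) y := by
      by_cases hy : p z = y
      · subst hy
        refine ⟨{.cons (hadj z) .nil}, fun W => ?_, by simp [signedValue]⟩
        rw [Finset.mem_singleton]
        constructor
        · rintro rfl
          exact ⟨(SimpleGraph.isCoaugmenting_cons_nil _).mpr ((hp _ _).mpr rfl), by simp⟩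
        · rintro ⟨-, hl⟩
          exact W.eq_cons_nil_of_length_eq_one (hadj z) hl
      · refine ⟨∅, fun W => ?_, by simp [hy]⟩
        simp only [Finset.notMem_empty, false_iff, not_and]
        intro hW hl
        obtain ⟨h, rfl⟩ := W.exists_eq_cons_nil_of_length_eq_one hl
        rw [SimpleGraph.isCoaugmenting_cons_nil, hp] at hW
        exact hy hW
    let ext : (b : {b // b ∈ T}) → X.underlying.Walk b.1 y → X.underlying.Walk z y :=
      fun b W => .cons (hadj z) (.cons (Finset.mem_filter.mp b.2).2.1 W)
    have hext : ∀ b W b' W', ext b W = ext b' W' → b = b' := by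
      intro b W b' W' h
      -- The third vertex of an extended walk is the successor `b`.
      have h1 := congrArg (fun W => W.support[2]?) h
      simp only [ext, SimpleGraph.Walk.support_cons] at h1
      rw [← SimpleGraph.Walk.cons_tail_support W, ← SimpleGraph.Walk.cons_tail_support W'] at h1
      exact Subtype.ext (by simpa using h1)
    have hextinj : ∀ b, Function.Injective (ext b) := by
      intro b W W' h
      simpa [ext] using h
    have hsv : ∀ b : {b // b ∈ T}, ∀ W ∈ S b.1, signedValue X α (ext b W) =
        - (X.hermitianAdj α z (p z) * (X.hermitianAdj α (p z) b.1 * signedValue X α W)) := by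
      intro b W hW
      have hR := (Finset.mem_filter.mp b.2).2
      -- With a nonempty `W` the subtraction in the exponent is not truncated, so two more edges
      -- raise it by one: this is the minus sign of the recursion.
      have hlen : 1 ≤ W.length := by
        have := (hS b.1 hR W).mp hW
        cases W with
        | nil => exact absurd this SimpleGraph.not_isCoaugmenting_nil
        | cons _ _ => simp
      have : (W.length + 1 + 1 - 1) / 2 = (W.length - 1) / 2 + 1 := by omega
      simp only [signedValue, ext, walkValue_cons, SimpleGraph.Walk.length_cons, this]
      ring
    let S₁ : Finset (X.underlying.Walk z y) :=
      T.attach.biUnion fun b => (S b.1).image (ext b)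
    have hS₁sum : ∑ W ∈ S₁, signedValue X α W = - (X.hermitianAdj α z (p z) *
        ∑ b ∈ T, X.hermitianAdj α (p z) b * (X.hermitianAdj α)⁻¹ b y) := by
      rw [Finset.sum_biUnion]
      · rw [← Finset.sum_attach T, Finset.mul_sum, ← Finset.sum_neg_distrib]
        refine Finset.sum_congr rfl fun b _ => ?_
        rw [Finset.sum_image (hextinj b).injOn, Finset.sum_congr rfl (hsv b),
          hSsum b.1 (Finset.mem_filter.mp b.2).2, Finset.mul_sum, Finset.mul_sum,
          Finset.sum_neg_distrib]
      · intro b _ b' _ hbb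
        rw [Function.onFun, Finset.disjoint_left]
        intro W hW hW'
        obtain ⟨U, -, rfl⟩ := Finset.mem_image.mp hW
        obtain ⟨U', -, hU⟩ := Finset.mem_image.mp hW'
        exact hbb (hext _ _ _ _ hU.symm)
    refine ⟨S₀ ∪ S₁, fun W => ?_, ?_⟩
    · rw [Finset.mem_union, hS₀]
      constructor
      · rintro (h | h)
        · exact h.1
        · obtain ⟨b, -, hb⟩ := Finset.mem_biUnion.mp h
          obtain ⟨U, hU, rfl⟩ := Finset.mem_image.mp hb
          have hR := (Finset.mem_filter.mp b.2).2
          exact SimpleGraph.IsCoaugmenting.cons_cons hbip hp hwf _ _ hR.2 ((hS _ hR _).mp hU)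
      · intro hW
        rcases hW.length_eq_one_or_eq_cons_cons with hl | ⟨b, c, h, h', U, rfl⟩
        · exact .inl ⟨hW, hl⟩
        · right
          have hW' := (SimpleGraph.isCoaugmenting_cons_cons _ _ _).mp hW
          obtain rfl := (hp _ _).mp hW'.1
          have hR : X.underlying.Adj (p z) c ∧ c ≠ z := by
            refine ⟨h', ?_⟩
            rintro rfl
            exact hW'.2.1 hW'.1.symm
          refine Finset.mem_biUnion.mpr ⟨⟨c, by simpa [hT] using hR⟩, Finset.mem_attach _ _, ?_⟩
          exact Finset.mem_image.mpr ⟨U, (hS c hR U).mpr hW'.2.2.1, rfl⟩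
    · rw [Finset.sum_union, hS₀sum, hS₁sum, hf]
      · ring
      · rw [Finset.disjoint_left]
        intro W hW hW'
        obtain ⟨b, -, hb⟩ := Finset.mem_biUnion.mp hW'
        obtain ⟨U, hU, rfl⟩ := Finset.mem_image.mp hb
        have := ((hS₀ _).mp hW).2
        simp [ext] at this

end Inverse

end MixedGraph

/-! ### Parity along alternating paths, and the edges where two of them separate. -/

lemma List.IsChain.even_length_iff {β : Type*} {p : β → Prop} : ∀ {l : List β} {a b : β},
    (a :: l).IsChain (fun e f => p e ↔ ¬ p f) → (a :: l).getLast? = some b →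
      (Even l.length ↔ (p a ↔ p b))
  | [], a, b, _, hb => by
    simp only [List.getLast?_singleton, Option.some.injEq] at hb
    simp [hb]
  | c :: l, a, b, h, hb => by
    rw [List.isChain_cons_cons] at h
    rw [List.getLast?_cons_cons] at hb
    have := h.2.even_length_iff hb
    rw [List.length_cons, Nat.even_add_one, this]
    tauto

namespace SimpleGraph

variable {V : Type*} {G : SimpleGraph V}

lemma IsCoaugmenting.reverse {M : G.Subgraph} {x y : V} {P : G.Walk x y}
    (h : IsCoaugmenting M P) : IsCoaugmenting M P.reverse := by
  refine ⟨(Walk.isPath_reverse_iff _).mpr h.isPath, ?_, ?_, ?_⟩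
  · rw [Walk.edges_reverse, List.isChain_reverse]
    exact h.alternating.imp fun _ _ => by tauto
  · simpa using h.last_mem
  · simpa using h.first_mem

lemma Walk.edges_eq_nil_or_eq_append {x v : V} (A : G.Walk x v) :
    A.edges = [] ∨ ∃ u l, A.edges = l ++ [s(u, v)] := by
  induction A with
  | nil => simp
  | @cons a b c h A ih =>
    right
    rcases ih with h0 | ⟨u, l, hl⟩
    · cases A with
      | nil => exact ⟨a, [], by simp⟩
      | cons _ _ => simp at h0
    · exact ⟨u, s(a, b) :: l, by simp [hl]⟩

lemma Walk.start_mem_of_head?_edges {v y : V} {D : G.Walk v y} {f : Sym2 V}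
    (h : D.edges.head? = some f) : v ∈ f := by
  cases D with
  | nil => simp at h
  | cons _ _ =>
    simp only [Walk.edges_cons, List.head?_cons, Option.some.injEq] at h
    rw [← h]
    exact Sym2.mem_mk_left _ _

lemma Subgraph.eq_of_mem_edgeSet {M : G.Subgraph} (hM : M.IsPerfectMatching) {v : V}
    {e f : Sym2 V} (he : e ∈ M.edgeSet) (hf : f ∈ M.edgeSet) (hve : v ∈ e) (hvf : v ∈ f) :
    e = f := by
  obtain ⟨a, rfl⟩ := Sym2.mem_iff_exists.mp hve
  obtain ⟨b, rfl⟩ := Sym2.mem_iff_exists.mp hvf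
  have hab : a = b := (Subgraph.isPerfectMatching_iff.mp hM v).unique he hf
  rw [hab]

/-- Two co-augmenting paths that separate at `v` reach `v` along a matching edge, and leave it
along non-matching edges. -/
lemma IsCoaugmenting.exists_matching_edge {M : G.Subgraph} (hM : M.IsPerfectMatching) {x v y : V}
    {A : G.Walk x v} {D D' : G.Walk v y} (h : IsCoaugmenting M (A.append D))
    (h' : IsCoaugmenting M (A.append D')) {f f' : Sym2 V} (hf : D.edges.head? = some f)
    (hf' : D'.edges.head? = some f') (hne : f ≠ f') :
    ∃ u, s(u, v) ∈ A.edges ∧ s(u, v) ∈ M.edgeSet ∧ f ∉ M.edgeSet := by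
  have hv := Walk.start_mem_of_head?_edges hf
  have hv' := Walk.start_mem_of_head?_edges hf'
  have hnot : ¬ (f ∈ M.edgeSet ∧ f' ∈ M.edgeSet) := fun hff =>
    hne (Subgraph.eq_of_mem_edgeSet hM hff.1 hff.2 hv hv')
  -- If `A` is empty, `f` and `f'` are both first edges, hence two matching edges at `v`. Otherwise
  -- both alternate with the last edge of `A`, and they cannot both be in `M`.
  rcases A.edges_eq_nil_or_eq_append with hA | ⟨u, l, hA⟩
  · obtain ⟨e, he, heM⟩ := h.first_mem
    obtain ⟨e', he', heM'⟩ := h'.first_mem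
    rw [Walk.edges_append, hA, List.nil_append] at he he'
    rw [hf, Option.some.injEq] at he
    rw [hf', Option.some.injEq] at he'
    subst he he'
    exact absurd ⟨heM, heM'⟩ hnot
  · obtain ⟨k, hk⟩ := List.head?_eq_some_iff.mp hf
    obtain ⟨k', hk'⟩ := List.head?_eq_some_iff.mp hf'
    have h1 := h.alternating
    have h2 := h'.alternating
    rw [Walk.edges_append, hA, hk, List.append_assoc, List.singleton_append,
      List.isChain_append_cons_cons] at h1
    rw [Walk.edges_append, hA, hk', List.append_assoc, List.singleton_append,
      List.isChain_append_cons_cons] at h2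
    refine ⟨u, by simp [hA], ?_⟩
    have := h1.2.1
    have := h2.2.1
    tauto

end SimpleGraph

/-! ### The formula for the entry. -/

open SimpleGraph in
theorem mainTheorem5 {V : Type*} [Fintype V] [DecidableEq V] (X : MixedGraph V)
    (α : ℂ) (hα : ‖α‖ = 1)
    (huni : X.underlying.IsUnicyclic) (hbip : X.underlying.IsBipartite)
    (M : X.underlying.Subgraph) (hM : M.IsPerfectMatching)
    (hMuniq : ∀ M' : X.underlying.Subgraph, M'.IsPerfectMatching → M' = M)
    {w : V} (C : X.underlying.Walk w w) (hC : C.IsCycle)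
    (m : ℕ) (hm : C.length = 2 * m)
    (hpegs : {e | SimpleGraph.IsPeg M C e}.ncard = 2)
    {x y : V} (P Q : X.underlying.Walk x y)
    (hP : SimpleGraph.IsCoaugmenting M P) (hQ : SimpleGraph.IsCoaugmenting M Q) (hPQ : P ≠ Q) :
    IsUnit (X.hermitianAdj α).det ∧
    ∃ (u v u' v' : V),
      {e | SimpleGraph.IsPeg M C e} = {s(u, v), s(u', v')} ∧ v ∈ C.support ∧ v' ∈ C.support ∧
      ∃ (Pxv : X.underlying.Walk x v) (F Fc : X.underlying.Walk v v')
        (Pv'y : X.underlying.Walk v' y),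
        -- `P` runs from `x` to `v`, then along `F` from `v` to `v'`, then from `v'` to `y`,
        -- and `F` is the part of `P` in the cycle
        P = Pxv.append (F.append Pv'y) ∧
        (∀ e, e ∈ F.edges ↔ e ∈ P.edges ∧ e ∈ C.edges) ∧
        -- `Fc` is the other path from `v` to `v'` in the cycle: `Fc` followed by the reverse of `F`
        -- traverses the cycle once
        Fc.IsPath ∧
        (Fc.append F.reverse).IsCycle ∧
        (∀ e, e ∈ (Fc.append F.reverse).edges ↔ e ∈ C.edges) ∧
        (X.hermitianAdj α)⁻¹ x y =
          (-1) ^ ((P.length - 1) / 2) *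
            (X.walkValue α Pxv * X.walkValue α Pv'y / X.walkValue α F.reverse) *
            ((-1) ^ (m + 1) * X.walkValue α (Fc.append F.reverse) + 1) := by
  have hcyc : ∀ (w' : V) (d : X.underlying.Walk w' w'), d.IsCycle →
      ∀ e, e ∈ d.edges ↔ e ∈ C.edges := by
    obtain ⟨-, w₀, c, -, hc⟩ := huni
    intro w' d hd e
    rw [hc _ d hd, hc _ C hC]
  obtain ⟨p, hp⟩ := exists_partner hM
  have hwf := wellFounded_alternating hbip hMuniq hp
  refine ⟨X.isUnit_det_hermitianAdj hα hp hwf, ?_⟩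
  obtain ⟨S, hS, hsum⟩ := X.inv_hermitianAdj_eq_sum hα hbip hp hwf x y
  have hSPQ : S = {P, Q} := by
    ext W
    rw [hS, Finset.mem_insert, Finset.mem_singleton]
    constructor
    · exact fun hW => hP.isPath.eq_or_eq_of_ne hC hcyc hQ.isPath hW.isPath hPQ
    · rintro (rfl | rfl) <;> assumption
  rw [hSPQ, Finset.sum_pair hPQ] at hsum
  have hPp := hP.isPath
  have hQp := hQ.isPath
  obtain ⟨v, v', A, F, F', B, hPe, hQe, hc⟩ :=
    hPp.exists_isCycle_append_of_ne_of_unique hcyc hQp hPQ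
  have hF'p : F'.IsPath := (hQe ▸ hQp).of_append_right.of_append_left
  have hFp : F.IsPath := (hPe ▸ hPp).of_append_right.of_append_left
  have hvv : v ≠ v' := by
    rintro rfl
    have h1 := Walk.eq_nil_iff_nil.mpr (Walk.isPath_iff_nil.mp hFp)
    have h2 := Walk.eq_nil_iff_nil.mpr (Walk.isPath_iff_nil.mp hF'p)
    subst h1 h2
    exact hc.ne_nil rfl
  have hne : ∀ D : X.underlying.Walk v v', D.edges ≠ [] := fun D h => by
    cases D with
    | nil => exact hvv rfl
    | cons _ _ => simp at h
  have hndP := hPp.isTrail.edges_nodup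
  have hndQ := hQp.isTrail.edges_nodup
  have hndc := hc.isTrail.edges_nodup
  have hcC := hcyc _ _ hc
  rw [hPe] at hndP
  rw [hQe] at hndQ
  have hFiff := Walk.IsTrail.mem_edges_middle_iff (hQe ▸ hQp.isTrail) hc.isTrail
  rw [← hPe] at hFiff
  simp only [Walk.edges_append, Walk.edges_reverse, List.nodup_append', List.mem_append,
    List.mem_reverse, List.disjoint_left] at hndP hndQ hndc hcC hFiff
  -- the two ends of `F`
  obtain ⟨f, hf⟩ : ∃ f, F.edges.head? = some f := ⟨_, List.head?_eq_some_head (hne F)⟩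
  obtain ⟨f', hf'⟩ : ∃ f', F'.edges.head? = some f' := ⟨_, List.head?_eq_some_head (hne F')⟩
  obtain ⟨g, hg⟩ : ∃ g, F.edges.getLast? = some g := ⟨_, List.getLast?_eq_some_getLast (hne F)⟩
  obtain ⟨g', hg'⟩ : ∃ g', F'.edges.getLast? = some g' :=
    ⟨_, List.getLast?_eq_some_getLast (hne F')⟩
  have hfm := List.mem_of_mem_head? hf
  have hf'm := List.mem_of_mem_head? hf'
  have hgm := List.mem_of_mem_getLast? hg
  have hg'm := List.mem_of_mem_getLast? hg'
  obtain ⟨u, huA, huM, hfM⟩ := IsCoaugmenting.exists_matching_edge hM (A := A)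
    (D := F.append B) (D' := F'.append B) (hPe ▸ hP) (hQe ▸ hQ)
    (f := f) (f' := f') (by simp [hf]) (by simp [hf'])
    (by rintro rfl; exact hndc.2.2 hf'm hfm)
  -- The end `v'` is treated by reversing both paths.
  obtain ⟨u', huB, huM', hgM⟩ := IsCoaugmenting.exists_matching_edge hM (A := B.reverse)
    (D := F.reverse.append A.reverse) (D' := F'.reverse.append A.reverse)
    (by have := hP.reverse; rwa [hPe, Walk.reverse_append, Walk.reverse_append,
          ← Walk.append_assoc] at this)
    (by have := hQ.reverse; rwa [hQe, Walk.reverse_append, Walk.reverse_append,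
          ← Walk.append_assoc] at this)
    (f := g) (f' := g') (by simp [hg]) (by simp [hg'])
    (by rintro rfl; exact hndc.2.2 hg'm hgm)
  rw [Walk.edges_reverse, List.mem_reverse] at huB
  have hvC : v ∈ C.support := Walk.mem_support_of_mem_edges ((hcC f).mp (.inr hfm))
    (Walk.start_mem_of_head?_edges hf)
  have hvC' : v' ∈ C.support := Walk.mem_support_of_mem_edges ((hcC g).mp (.inr hgm))
    (Walk.start_mem_of_head?_edges (D := F.reverse) (by simpa using hg))
  have hpeg : IsPeg M C s(u, v) := by
    refine ⟨huM, fun h => ?_, v, hvC, Sym2.mem_mk_right _ _⟩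
    rcases (hcC _).mpr h with h | h
    · exact hndQ.2.2 huA (.inl h)
    · exact hndP.2.2 huA (.inl h)
  have hpeg' : IsPeg M C s(u', v') := by
    refine ⟨huM', fun h => ?_, v', hvC', Sym2.mem_mk_right _ _⟩
    rcases (hcC _).mpr h with h | h
    · exact hndQ.2.1.2.2 h huB
    · exact hndP.2.1.2.2 h huB
  have hpne : s(u, v) ≠ s(u', v') := fun h => hndP.2.2 huA (.inr (h ▸ huB))
  have hset : {e | IsPeg M C e} = {s(u, v), s(u', v')} := by
    symm
    refine Set.eq_of_subset_of_ncard_le ?_ ?_ (Set.toFinite _)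
    · rintro e (rfl | rfl) <;> assumption
    · rw [hpegs, Set.ncard_pair hpne]
  refine ⟨u, v, u', v', hset, hvC, hvC', A, F, F', B, hPe, ?_, hF'p, hc, hcyc _ _ hc, ?_⟩
  · intro e
    rw [hFiff, hcC]
  -- parities
  have hPodd : ¬ Even P.length := by
    obtain ⟨e, he, heM⟩ := hP.first_mem
    obtain ⟨e', he', heM'⟩ := hP.last_mem
    obtain ⟨l, hl⟩ := List.head?_eq_some_iff.mp he
    have := (hl ▸ hP.alternating).even_length_iff (hl ▸ he')
    rw [← Walk.length_edges, hl, List.length_cons, Nat.even_add_one, this]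
    tauto
  -- Both end edges of `F` are outside `M`, since the pegs precede and follow it.
  have hFodd : ¬ Even F.length := by
    obtain ⟨l, hl⟩ := List.head?_eq_some_iff.mp hf
    have hch := hP.alternating
    rw [hPe, Walk.edges_append, Walk.edges_append] at hch
    have := (hl ▸ hch.right_of_append.left_of_append).even_length_iff (hl ▸ hg)
    rw [← Walk.length_edges, hl, List.length_cons, Nat.even_add_one, this]
    tauto
  have hlen : F'.length + F.length = 2 * m := by
    rw [← hm, ← Walk.length_edges C, ← Walk.length_reverse F, ← Walk.length_append,
      ← Walk.length_edges]
    exact ((List.perm_ext_iff_of_nodup hc.isTrail.edges_nodup hC.isTrail.edges_nodup).mpr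
      (hcyc _ _ hc)).length_eq
  have hPlen : P.length = A.length + (F.length + B.length) := by simp [hPe]
  have hQlen : Q.length = A.length + (F'.length + B.length) := by simp [hQe]
  obtain ⟨i, hi⟩ := Nat.not_even_iff_odd.mp hFodd
  obtain ⟨k, hk⟩ := Nat.not_even_iff_odd.mp hPodd
  -- The lengths of `F`, `F'` and `P` are `2i + 1`, `2j + 1` and `2k + 1`, so the exponent for `Q`
  -- is `k + j - i`, of the same parity as `k + m + 1`.
  obtain ⟨j, hj⟩ : ∃ j, m = i + j + 1 := ⟨m - i - 1, by omega⟩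
  have hPexp : (P.length - 1) / 2 = k := by omega
  have hQexp : (Q.length - 1) / 2 + i = k + j := by omega
  have hrev := X.walkValue_mul_reverse hα F
  have hinv : (X.walkValue α F.reverse)⁻¹ = X.walkValue α F :=
    (eq_inv_of_mul_eq_one_left hrev).symm
  have hi2 : ((-1 : ℂ) ^ i) * (-1) ^ i = 1 := by rw [← mul_pow]; simp
  have hsQ : (-1 : ℂ) ^ ((Q.length - 1) / 2) = (-1) ^ k * (-1) ^ j * (-1) ^ i := by
    rw [← pow_add, ← hQexp, pow_add, mul_assoc, hi2, mul_one]
  rw [hsum, MixedGraph.signedValue, MixedGraph.signedValue, hsQ, hPexp, div_eq_mul_inv, hinv]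
  rw [hPe, hQe, hj]
  simp only [X.walkValue_append, pow_add, pow_one]
  -- The term of `Q` becomes a multiple of that of `P` on inserting `h(F) h(F.reverse) = 1`.
  linear_combination (-(-1 : ℂ) ^ k * (-1) ^ j * (-1) ^ i * X.walkValue α A * X.walkValue α F' *
    X.walkValue α B) * hrev
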